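/- Let $K$ be a field of characteristic $0$; an algebra is a $K$-vector space with a bilinear (not necessarily associative) product. A Zinbiel algebra is an algebra satisfying $a(bc)=(ab+ba)c$. A Tortkara algebra is an anticommutative algebra satisfying $(ab)(cb)=J(a,b,c)\,b$, where $J(a,b,c)=(ab)c+(bc)a+(ca)b$. For a Zinbiel algebra $A$, let $A^{(-)}$ be the vector space $A$ with the product $[a,b]=ab-ba$. A Tortkara algebra is special if it is isomorphic to a subalgebra of $A^{(-)}$ for some Zinbiel algebra $A$. Let $\mathrm{Zin}(\{x,y\})$ and $T(\{x,y\})$ be the free Zinbiel and the free Tortkara algebra on two generators $x,y$, and let $ST(\{x,y\})$ be the subalgebra of $\mathrm{Zin}(\{x,y\})^{(-)}$ generated by $x$ and $y$. Theorem. The free Tortkara algebra $T(\{x,y\})$ is special. More precisely: 1. There is an isomorphism of algebras $T(\{x,y\})\to ST(\{x,y\})$ sending $x\mapsto x$ and $y\mapsto y$. 2. For every $n$, the homogeneous component $T_n$ of $T(\{x,y\})$ (the span of all bracketed monomials of degree $n$ in $x,y$) is spanned by the left-normed monomials $(\cdots((z_1z_2)z_3)\cdots)z_n$ with $z_i\in\{x,y\}$.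 3. The left-normed elements form a basis of $T(\{x,y\})$; that is, up to anticommutativity: the elements $x$, $y$ and $(\cdots(((xy)z_1)z_2)\cdots)z_m$, indexed by $m\ge 0$ and $(z_1,\dots,z_m)\in\{x,y\}^m$, form a basis of the vector space $T(\{x,y\})$. -/

import Mathlib

/-!
Nonassociative algebras over a field `K` are modelled as usual in Mathlib: a
`NonUnitalNonAssocRing A` with `Module K A`, `IsScalarTower K A A`, `SMulCommClass K A A`
(that is, a `K`-vector space with a `K`-bilinear product); homomorphisms are `A →ₙₐ[K] B`.
-/

universe u v

noncomputable section

/-- The (right) Zinbiel identity `a (b c) = (a b + b a) c`. -/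
def IsZinbiel (A : Type v) [NonUnitalNonAssocRing A] : Prop :=
  ∀ a b c : A, a * (b * c) = (a * b + b * a) * c

/-- The Jacobian `J(a,b,c) = (a b) c + (b c) a + (c a) b`. -/
def jacobian {A : Type v} [NonUnitalNonAssocRing A] (a b c : A) : A :=
  (a * b) * c + (b * c) * a + (c * a) * b

/-- Tortkara algebras: anticommutative algebras with `(a b)(c b) = J(a,b,c) b`. -/
def IsTortkara (A : Type v) [NonUnitalNonAssocRing A] : Prop :=
  (∀ a b : A, a * b = -(b * a)) ∧
    ∀ a b c : A, (a * b) * (c * b) = jacobian a b c * b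

/-! ### The commutator algebra -/

/-- The commutator (minus) algebra `A⁽⁻⁾`: the same vector space as `A`,
with product `[a, b] = a b - b a`. -/
def MinusAlgebra (A : Type v) : Type v := A

namespace MinusAlgebra

variable {A : Type v}

/-- The identity map `A → A⁽⁻⁾`. -/
def of (a : A) : MinusAlgebra A := a

/-- The identity map `A⁽⁻⁾ → A`. -/
def out (a : MinusAlgebra A) : A := a

variable [NonUnitalNonAssocRing A]

instance : AddCommGroup (MinusAlgebra A) := inferInstanceAs (AddCommGroup A)

instance : Mul (MinusAlgebra A) := ⟨fun a b => of (a.out * b.out - b.out * a.out)⟩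

theorem mul_def (a b : MinusAlgebra A) : a * b = of (a.out * b.out - b.out * a.out) := rfl

instance : NonUnitalNonAssocRing (MinusAlgebra A) :=
  { (inferInstance : AddCommGroup (MinusAlgebra A)),
    (inferInstance : Mul (MinusAlgebra A)) with
    left_distrib := fun a b c => by
      change a.out * (b.out + c.out) - (b.out + c.out) * a.out =
        (a.out * b.out - b.out * a.out) + (a.out * c.out - c.out * a.out)
      rw [mul_add, add_mul]; abel
    right_distrib := fun a b c => by
      change (a.out + b.out) * c.out - c.out * (a.out + b.out) =
        (a.out * c.out - c.out * a.out) + (b.out * c.out - c.out * b.out)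
      rw [mul_add, add_mul]; abel
    zero_mul := fun a => by
      change (0 : A) * a.out - a.out * 0 = 0
      simp
    mul_zero := fun a => by
      change a.out * (0 : A) - 0 * a.out = 0
      simp }

variable {K : Type u} [Field K] [Module K A]

instance : Module K (MinusAlgebra A) := inferInstanceAs (Module K A)

variable [IsScalarTower K A A] [SMulCommClass K A A]

instance : IsScalarTower K (MinusAlgebra A) (MinusAlgebra A) :=
  ⟨fun k a b => by
    change (k • a.out) * b.out - b.out * (k • a.out) = k • (a.out * b.out - b.out * a.out)
    rw [smul_mul_assoc, mul_smul_comm, smul_sub]⟩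

instance : SMulCommClass K (MinusAlgebra A) (MinusAlgebra A) :=
  ⟨fun k a b => by
    change k • (a.out * b.out - b.out * a.out) = a.out * (k • b.out) - (k • b.out) * a.out
    rw [smul_mul_assoc, mul_smul_comm, smul_sub]⟩

end MinusAlgebra

/-- A Tortkara algebra `B` over `K` is special if it embeds into `A⁽⁻⁾` for some Zinbiel algebra
`A` over `K`. -/
def IsSpecialTortkara (K : Type u) [Field K] (B : Type v) [NonUnitalNonAssocRing B] [Module K B] :
    Prop :=
  IsTortkara B ∧
    ∃ (A : Type v) (_ : NonUnitalNonAssocRing A) (_ : Module K A)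
      (_ : IsScalarTower K A A) (_ : SMulCommClass K A A),
      IsZinbiel A ∧ ∃ φ : B →ₙₐ[K] MinusAlgebra A, Function.Injective φ

/-! ### Algebras given by generators and relations -/

section Presented

variable (K : Type u) [Field K] {X : Type v}

/-- The two-sided ideal of the free nonassociative algebra generated by a set `S`: the smallest
subspace containing `S` and closed under left and right multiplication by arbitrary elements. -/
def relatorIdeal (S : Set (FreeNonUnitalNonAssocAlgebra K X)) :
    Submodule K (FreeNonUnitalNonAssocAlgebra K X) :=
  sInf {N | S ⊆ N ∧ ∀ a, ∀ n ∈ N, a * n ∈ N ∧ n * a ∈ N}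

theorem subset_relatorIdeal (S : Set (FreeNonUnitalNonAssocAlgebra K X)) :
    S ⊆ relatorIdeal K S := fun _ hs =>
  Submodule.mem_sInf.2 fun _ hN => hN.1 hs

theorem mul_mem_relatorIdeal (S : Set (FreeNonUnitalNonAssocAlgebra K X))
    (a : FreeNonUnitalNonAssocAlgebra K X) {n : FreeNonUnitalNonAssocAlgebra K X}
    (hn : n ∈ relatorIdeal K S) : a * n ∈ relatorIdeal K S ∧ n * a ∈ relatorIdeal K S :=
  ⟨Submodule.mem_sInf.2 fun N hN => (hN.2 a n (Submodule.mem_sInf.1 hn N hN)).1,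
    Submodule.mem_sInf.2 fun N hN => (hN.2 a n (Submodule.mem_sInf.1 hn N hN)).2⟩

/-- The algebra generated by `X` with relators `S`: the quotient of the free nonassociative
`K`-algebra on `X` by the two-sided ideal generated by `S`. -/
def PresentedAlgebra (S : Set (FreeNonUnitalNonAssocAlgebra K X)) : Type (max u v) :=
  FreeNonUnitalNonAssocAlgebra K X ⧸ relatorIdeal K S

namespace PresentedAlgebra

variable (S : Set (FreeNonUnitalNonAssocAlgebra K X))

instance : AddCommGroup (PresentedAlgebra K S) :=
  inferInstanceAs (AddCommGroup (FreeNonUnitalNonAssocAlgebra K X ⧸ relatorIdeal K S))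

instance : Module K (PresentedAlgebra K S) :=
  inferInstanceAs (Module K (FreeNonUnitalNonAssocAlgebra K X ⧸ relatorIdeal K S))

/-- The quotient map. -/
def mk : FreeNonUnitalNonAssocAlgebra K X →ₗ[K] PresentedAlgebra K S :=
  (relatorIdeal K S).mkQ

theorem mk_surjective : Function.Surjective (mk K S) :=
  Submodule.mkQ_surjective _

theorem mk_eq_mk {a b : FreeNonUnitalNonAssocAlgebra K X} :
    mk K S a = mk K S b ↔ a - b ∈ relatorIdeal K S :=
  Submodule.Quotient.eq _

instance : Mul (PresentedAlgebra K S) :=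
  ⟨Quotient.map₂ (· * ·) fun a a' ha b b' hb => by
    have ha' := (Submodule.quotientRel_def _).1 ha
    have hb' := (Submodule.quotientRel_def _).1 hb
    refine (Submodule.quotientRel_def _).2 ?_
    have h : a * b - a' * b' = (a - a') * b + a' * (b - b') := by
      rw [sub_mul, mul_sub]; abel
    rw [h]
    exact Submodule.add_mem _ (mul_mem_relatorIdeal K S b ha').2
      (mul_mem_relatorIdeal K S a' hb').1⟩

theorem mk_mul (a b : FreeNonUnitalNonAssocAlgebra K X) :
    mk K S (a * b) = mk K S a * mk K S b := rfl

instance : NonUnitalNonAssocRing (PresentedAlgebra K S) :=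
  { (inferInstance : AddCommGroup (PresentedAlgebra K S)),
    (inferInstance : Mul (PresentedAlgebra K S)) with
    left_distrib := fun a b c => by
      obtain ⟨a, rfl⟩ := mk_surjective K S a
      obtain ⟨b, rfl⟩ := mk_surjective K S b
      obtain ⟨c, rfl⟩ := mk_surjective K S c
      change mk K S a * (mk K S b + mk K S c) = mk K S a * mk K S b + mk K S a * mk K S c
      rw [← map_add, ← mk_mul, ← mk_mul, ← mk_mul, ← map_add, mul_add]
    right_distrib := fun a b c => by
      obtain ⟨a, rfl⟩ := mk_surjective K S a
      obtain ⟨b, rfl⟩ := mk_surjective K S b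
      obtain ⟨c, rfl⟩ := mk_surjective K S c
      change (mk K S a + mk K S b) * mk K S c = mk K S a * mk K S c + mk K S b * mk K S c
      rw [← map_add, ← mk_mul, ← mk_mul, ← mk_mul, ← map_add, add_mul]
    zero_mul := fun a => by
      obtain ⟨a, rfl⟩ := mk_surjective K S a
      change (0 : PresentedAlgebra K S) * mk K S a = 0
      rw [← map_zero (mk K S), ← mk_mul, zero_mul]
    mul_zero := fun a => by
      obtain ⟨a, rfl⟩ := mk_surjective K S a
      change mk K S a * (0 : PresentedAlgebra K S) = 0
      rw [← map_zero (mk K S), ← mk_mul, mul_zero] }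

instance : IsScalarTower K (PresentedAlgebra K S) (PresentedAlgebra K S) :=
  ⟨fun k a b => by
    obtain ⟨a, rfl⟩ := mk_surjective K S a
    obtain ⟨b, rfl⟩ := mk_surjective K S b
    rw [smul_eq_mul, smul_eq_mul, ← map_smul, ← mk_mul, ← mk_mul, ← map_smul, smul_mul_assoc]⟩

instance : SMulCommClass K (PresentedAlgebra K S) (PresentedAlgebra K S) :=
  ⟨fun k a b => by
    obtain ⟨a, rfl⟩ := mk_surjective K S a
    obtain ⟨b, rfl⟩ := mk_surjective K S b
    rw [smul_eq_mul, smul_eq_mul, ← map_smul, ← mk_mul, ← mk_mul, ← map_smul, mul_smul_comm]⟩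

/-- The generators. -/
def of (x : X) : PresentedAlgebra K S := mk K S (FreeNonUnitalNonAssocAlgebra.of K x)

end PresentedAlgebra

end Presented

section Free

variable (K : Type u) [Field K] (X : Type v)

/-- All instances of the Zinbiel identity in the free nonassociative algebra. -/
def zinbielRelators : Set (FreeNonUnitalNonAssocAlgebra K X) :=
  {r | ∃ a b c, r = a * (b * c) - (a * b + b * a) * c}

/-- All instances of the Tortkara identities in the free nonassociative algebra. -/
def tortkaraRelators : Set (FreeNonUnitalNonAssocAlgebra K X) :=
  {r | (∃ a b, r = a * b + b * a) ∨
    ∃ a b c, r = (a * b) * (c * b) - jacobian a b c * b}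

/-- The free Zinbiel algebra `Zin(X)`. -/
abbrev FreeZinbiel : Type (max u v) := PresentedAlgebra K (zinbielRelators K X)

/-- The free Tortkara algebra `T(X)`. -/
abbrev FreeTortkara : Type (max u v) := PresentedAlgebra K (tortkaraRelators K X)

/-- `ST(X)`: the subalgebra of `Zin(X)⁽⁻⁾` generated by `X`. -/
def freeSpecialTortkara : NonUnitalSubalgebra K (MinusAlgebra (FreeZinbiel K X)) :=
  NonUnitalAlgebra.adjoin K
    (Set.range fun x : X => MinusAlgebra.of (PresentedAlgebra.of K (zinbielRelators K X) x))

variable {X}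

/-- The generator `x ∈ X` as an element of `T(X)`. -/
def FreeTortkara.of (x : X) : FreeTortkara K X := PresentedAlgebra.of K (tortkaraRelators K X) x

/-- The generator `x ∈ X` as an element of `ST(X)`. -/
def freeSpecialTortkara.of (x : X) : freeSpecialTortkara K X :=
  ⟨MinusAlgebra.of (PresentedAlgebra.of K (zinbielRelators K X) x),
    NonUnitalAlgebra.subset_adjoin K ⟨x, rfl⟩⟩

/-- The left-normed monomial `(⋯((x z₁) z₂)⋯) zₘ` in `T(X)`, of degree `m + 1`. -/
def leftNormed (x : X) (l : List X) : FreeTortkara K X :=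
  l.foldl (fun a z => a * FreeTortkara.of K z) (FreeTortkara.of K x)

variable (X)

/-- The homogeneous component `T_n` of `T(X)`: the span of all (arbitrarily bracketed) monomials
of degree `n` in the generators. -/
def homogeneousComponent (n : ℕ) : Submodule K (FreeTortkara K X) :=
  Submodule.span K
    {t | ∃ w : FreeMagma X, w.length = n ∧
      t = PresentedAlgebra.mk K (tortkaraRelators K X)
        (MonoidAlgebra.ofMagma K (FreeMagma X) w)}

end Free

/-- The left-normed elements of `T({x₀, x₁})` up to anticommutativity: the generators `x₀`, `x₁`
and the monomials `(⋯((x₀ x₁) z₁)⋯) zₘ` with `m ≥ 0` and all `zᵢ ∈ {x₀, x₁}`. -/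
def leftNormedFamily (K : Type u) [Field K] :
    Fin 2 ⊕ List (Fin 2) → FreeTortkara K (Fin 2)
  | Sum.inl i => FreeTortkara.of K i
  | Sum.inr l => leftNormed K 0 (1 :: l)

end

/-! ### Commutators in Zinbiel algebras, and products of left-normed elements in Tortkara algebras.
-/

section Tortkara

/-! The canonical map T → ST is onto, so everything rests on two facts about left-normed monomials:
they span T, and, up to anticommutativity, their images in a concrete Zinbiel algebra are
independent.

Spanning (`IsTortkara.mul_mem_of_leftNormed`): in the polarized identity (ab)(cd) + (ad)(cb) =
J(a,b,c)d + J(a,d,c)b with b, d generators, the right side is left-normed by induction on the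
degree. So exchanging the last letters of two factors only changes the sign, modulo left-normed
elements. With two letters x, y this reduces every product to the form (ax)(by), which is settled by
induction on the degree of a.

Independence: T maps through ST to words with the half-shuffle a * (zb) = z(a ⧢ b), for a without
constant term. With u = yx - xy, `bracketCons_bracket` gives [uf, z] = -u R_z(f), where R_z(f) = z ⧢
f + zf. Hence the monomial (xy)z₁⋯zₘ goes to ±u R_{zₘ}⋯R_{z₁}(1). These are independent because ∑
R_z(f_z) = (E + 1)(∑ z f_z) for the Euler operator E = ∑ z ⧢ ∂_z (`sum_rightOp`), and E + 1 is
injective on series of bounded length in characteristic 0 (`eq_zero_of_euler_add_self`).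

A linear map that factors through ST and is independent on a spanning family is injective; so T → ST
is injective. -/

theorem IsZinbiel.isTortkara_minusAlgebra {A : Type v} [NonUnitalNonAssocRing A]
    (h : IsZinbiel A) : IsTortkara (MinusAlgebra A) := by
  constructor
  · intro a b
    change a.out * b.out - b.out * a.out = -(b.out * a.out - a.out * b.out)
    abel
  · have key : ∀ a b c : A,
        (a * b - b * a) * (c * b - b * c) - (c * b - b * c) * (a * b - b * a) =
          (((a * b - b * a) * c - c * (a * b - b * a)) +
            ((b * c - c * b) * a - a * (b * c - c * b)) +
            ((c * a - a * c) * b - b * (c * a - a * c))) * b -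
          b * (((a * b - b * a) * c - c * (a * b - b * a)) +
            ((b * c - c * b) * a - a * (b * c - c * b)) +
            ((c * a - a * c) * b - b * (c * a - a * c))) := by
      intro a b c
      -- Used as a rewrite rule, this turns every monomial into left-normed ones, where both sides
      -- agree term by term.
      have h' : ∀ a b c : A, a * (b * c) = (a * b) * c + (b * a) * c := fun a b c => by
        rw [h, add_mul]
      simp only [mul_add, add_mul, mul_sub, sub_mul, h']
      abel
    exact fun a b c => key a.out b.out c.out

namespace IsTortkara

variable {B : Type v} [NonUnitalNonAssocRing B]

/-- Polarization of the Tortkara identity in its repeated variable, via b + d. -/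
theorem mul_mul_add (h : IsTortkara B) (a b c d : B) :
    (a * b) * (c * d) + (a * d) * (c * b) = jacobian a b c * d + jacobian a d c * b := by
  have h1 := h.2 a (b + d) c
  have h2 := h.2 a b c
  have h3 := h.2 a d c
  have hJ : jacobian a (b + d) c = jacobian a b c + jacobian a d c := by
    simp only [jacobian, mul_add, add_mul]; abel
  rw [hJ] at h1
  simp only [mul_add, add_mul] at h1 ⊢
  rw [h2, h3] at h1
  have h4 := congrArg (fun t => t - jacobian a b c * b - jacobian a d c * d) h1
  convert h4 using 1 <;> abel

theorem mul_self (K : Type u) [Field K] [CharZero K] [Module K B] (h : IsTortkara B) (a : B) : a * a = 0 := by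
  have h1 : (2 : K) • (a * a) = 0 := by
    rw [two_smul]
    nth_rewrite 1 [h.1 a a]
    exact neg_add_cancel _
  exact (smul_eq_zero.1 h1).resolve_left two_ne_zero

variable {K : Type u} [Field K] [Module K B] [IsScalarTower K B B] [SMulCommClass K B B]

/-- If the subspaces `M p` (to be thought of as spanned by the left-normed monomials of degree
`p + 1`) satisfy `M (p + 1) = M p * x + M p * y`, then they form a grading of the product. -/
theorem mul_mem_of_leftNormed (h : IsTortkara B) (hs : ∀ a : B, a * a = 0) {x y : B}
    {M : ℕ → Submodule K B} (hx : x ∈ M 0) (hy : y ∈ M 0)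
    (h0 : ∀ a ∈ M 0, ∃ c d : K, a = c • x + d • y)
    (hsucc : ∀ p, ∀ a ∈ M (p + 1), ∃ b ∈ M p, ∃ c ∈ M p, a = b * x + c * y)
    (hmx : ∀ p, ∀ a ∈ M p, a * x ∈ M (p + 1)) (hmy : ∀ p, ∀ a ∈ M p, a * y ∈ M (p + 1))
    (n : ℕ) : ∀ p q, p + q = n → ∀ a ∈ M p, ∀ b ∈ M q, a * b ∈ M (n + 1) := by
  induction n using Nat.strong_induction_on with
  | _ n ih =>
  have hgen : ∀ p, ∀ a ∈ M p, ∀ z ∈ M 0, a * z ∈ M (p + 1) := by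
    intro p a ha z hz
    obtain ⟨c, d, rfl⟩ := h0 z hz
    rw [mul_add, mul_smul_comm, mul_smul_comm]
    exact add_mem (Submodule.smul_mem _ _ (hmx _ _ ha)) (Submodule.smul_mem _ _ (hmy _ _ ha))
  have hgen' : ∀ p, ∀ a ∈ M p, ∀ z ∈ M 0, z * a ∈ M (p + 1) := by
    intro p a ha z hz
    rw [h.1]
    exact neg_mem (hgen p a ha z hz)
  have hih : ∀ p q m, p + q + 1 = m → m ≤ n → ∀ a ∈ M p, ∀ b ∈ M q, a * b ∈ M m := by
    rintro p q m rfl hm a ha b hb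
    exact ih (p + q) (by omega) p q rfl a ha b hb
  have hJ : ∀ p q r m, p + q + r + 2 = m → m ≤ n → ∀ a ∈ M p, ∀ b ∈ M q, ∀ c ∈ M r,
      jacobian a b c ∈ M m := by
    rintro p q r m rfl hm a ha b hb c hc
    refine add_mem (add_mem ?_ ?_) ?_
    · exact hih (p + q + 1) r _ (by omega) hm _ (hih p q _ rfl (by omega) a ha b hb) c hc
    · exact hih (q + r + 1) p _ (by omega) hm _ (hih q r _ rfl (by omega) b hb c hc) a ha
    · exact hih (r + p + 1) q _ (by omega) hm _ (hih r p _ rfl (by omega) c hc a ha) b hb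
  -- The Jacobian has lower total degree, so the outer induction places it in `M n`; only a
  -- multiplication by a generator remains.
  have hsame : ∀ p q, p + q + 2 = n → ∀ a ∈ M p, ∀ b ∈ M q, ∀ z ∈ M 0,
      (a * z) * (b * z) ∈ M (n + 1) := by
    intro p q hpq a ha b hb z hz
    rw [h.2]
    exact hgen _ _ (hJ p 0 q n (by omega) le_rfl a ha z hz b hb) z hz
  have hswap : ∀ p q, p + q + 2 = n → ∀ a ∈ M p, ∀ b ∈ M q, ∀ z ∈ M 0, ∀ w ∈ M 0,
      (a * w) * (b * z) ∈ M (n + 1) → (a * z) * (b * w) ∈ M (n + 1) := by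
    intro p q hpq a ha b hb z hz w hw hm
    have h1 := h.mul_mul_add a z b w
    rw [eq_sub_of_add_eq h1]
    refine sub_mem (add_mem ?_ ?_) hm
    · exact hgen _ _ (hJ p 0 q n (by omega) le_rfl a ha z hz b hb) w hw
    · exact hgen _ _ (hJ p 0 q n (by omega) le_rfl a ha w hw b hb) z hz
  -- Swapping last letters in (xy)(bx) produces (xx)(by) = 0.
  have hxy : 2 ≤ n → ∀ a ∈ M (n - 1), (x * y) * a ∈ M (n + 1) := by
    intro hn a ha
    obtain ⟨m, rfl⟩ : ∃ m, n = m + 2 := ⟨n - 2, by omega⟩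
    obtain ⟨b, hb, c, hc, rfl⟩ := hsucc m a ha
    rw [mul_add]
    refine add_mem (hswap 0 m (by omega) x hx b hb y hy x hx ?_)
      (hsame 0 m (by omega) x hx c hc y hy)
    rw [hs, zero_mul]
    exact zero_mem _
  have hmain : ∀ p q, p + q + 2 = n → ∀ a ∈ M p, ∀ b ∈ M q,
      (a * x) * (b * y) ∈ M (n + 1) := by
    intro p
    induction p with
    | zero =>
      intro q hpq a ha b hb
      obtain ⟨c, d, rfl⟩ := h0 a ha
      rw [add_mul, add_mul, smul_mul_assoc, smul_mul_assoc, smul_mul_assoc, smul_mul_assoc, hs,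
        zero_mul, smul_zero, zero_add]
      refine Submodule.smul_mem _ _ (hswap 0 q hpq y hy b hb x hx y hy ?_)
      rw [hs, zero_mul]
      exact zero_mem _
    -- Polarizing with a in the place of a letter moves it out of the first factor. The only hard
    -- term is J(x,y,b)a: expanding both factors by last letters leaves a₁, a₂ of degree one less
    -- than a, and `ihp` allows any degree in the other factor.
    | succ p ihp =>
      intro q hpq a ha b hb
      have h1 := h.mul_mul_add x a b y
      have h2 : (a * x) * (b * y) =
          (x * y) * (b * a) - jacobian x a b * y - jacobian x y b * a := by
        rw [h.1 a x, neg_mul, eq_sub_of_add_eq h1]; abel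
      rw [h2]
      refine sub_mem (sub_mem ?_ ?_) ?_
      · exact hxy (by omega) _ (hih q (p + 1) _ (by omega) (by omega) b hb a ha)
      · exact hmy _ _ (hJ 0 (p + 1) q n (by omega) le_rfl x hx a ha b hb)
      · obtain ⟨α, hα, β, hβ, hαβ⟩ :=
          hsucc (q + 1) _ (hJ 0 0 q _ (by omega) (by omega) x hx y hy b hb)
        obtain ⟨a₁, ha₁, a₂, ha₂, rfl⟩ := hsucc p a ha
        rw [hαβ, add_mul, mul_add, mul_add]
        refine add_mem (add_mem ?_ ?_) (add_mem ?_ ?_)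
        · exact hsame _ _ (by omega) α hα a₁ ha₁ x hx
        · rw [h.1]
          exact neg_mem (hswap _ _ (by omega) _ ha₂ _ hα y hy x hx
            (ihp _ (by omega) _ ha₂ _ hα))
        · rw [h.1]
          exact neg_mem (ihp _ (by omega) _ ha₁ _ hβ)
        · exact hsame _ _ (by omega) β hβ a₂ ha₂ y hy
  intro p q hpq a ha b hb
  rcases p with _ | p
  · obtain rfl : q = n := by omega
    exact hgen' _ _ hb _ ha
  rcases q with _ | q
  · obtain rfl : p + 1 = n := by omega
    exact hgen _ _ ha _ hb
  obtain ⟨a₁, ha₁, a₂, ha₂, rfl⟩ := hsucc p a ha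
  obtain ⟨b₁, hb₁, b₂, hb₂, rfl⟩ := hsucc q b hb
  rw [add_mul, mul_add, mul_add]
  refine add_mem (add_mem ?_ ?_) (add_mem ?_ ?_)
  · exact hsame p q (by omega) _ ha₁ _ hb₁ x hx
  · exact hmain p q (by omega) _ ha₁ _ hb₂
  · rw [h.1]
    exact neg_mem (hmain q p (by omega) _ hb₁ _ ha₂)
  · exact hsame p q (by omega) _ ha₂ _ hb₂ y hy

end IsTortkara

end Tortkara
-- The Zinbiel algebra of words under the half-shuffle.
noncomputable section ShuffleAlgebra

/-- Formal series in words over `X`, with coefficients in `K`. -/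
def WordSeries (K : Type u) (X : Type v) : Type (max u v) := List X → K

namespace WordSeries

variable {K : Type u} [Field K] {X : Type v}

instance : AddCommGroup (WordSeries K X) := inferInstanceAs (AddCommGroup (List X → K))

instance : Module K (WordSeries K X) := inferInstanceAs (Module K (List X → K))

@[ext] theorem ext {K : Type u} {X : Type v} {f g : WordSeries K X} (h : ∀ l, f l = g l) :
    f = g := funext h

@[simp] theorem add_apply (f g : WordSeries K X) (l : List X) : (f + g) l = f l + g l := rfl
@[simp] theorem sub_apply (f g : WordSeries K X) (l : List X) : (f - g) l = f l - g l := rfl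
@[simp] theorem neg_apply (f : WordSeries K X) (l : List X) : (-f) l = -f l := rfl
@[simp] theorem zero_apply (l : List X) : (0 : WordSeries K X) l = 0 := rfl
@[simp] theorem smul_apply (k : K) (f : WordSeries K X) (l : List X) : (k • f) l = k * f l := rfl

/-- The derivation deleting the first letter `a`. -/
def der (a : X) : WordSeries K X →ₗ[K] WordSeries K X where
  toFun f := fun l => f (a :: l)
  map_add' _ _ := rfl
  map_smul' _ _ := rfl

@[simp] theorem der_apply (a : X) (f : WordSeries K X) (l : List X) : der a f l = f (a :: l) := rfl

/-- Coefficients of the shuffle product. -/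
def shuffleAux : WordSeries K X → WordSeries K X → List X → K
  | f, g, [] => f [] * g []
  | f, g, a :: l => shuffleAux (der a f) g l + shuffleAux f (der a g) l

theorem shuffleAux_add_left (l : List X) : ∀ f f' g : WordSeries K X,
    shuffleAux (f + f') g l = shuffleAux f g l + shuffleAux f' g l := by
  induction l with
  | nil => intro f f' g; simp [shuffleAux, add_mul]
  | cons a l ih => intro f f' g; simp only [shuffleAux, map_add, ih]; ring

theorem shuffleAux_smul_left (l : List X) : ∀ (k : K) (f g : WordSeries K X),
    shuffleAux (k • f) g l = k * shuffleAux f g l := by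
  induction l with
  | nil => intro k f g; simp [shuffleAux, mul_assoc]
  | cons a l ih => intro k f g; simp only [shuffleAux, map_smul, ih]; ring

theorem shuffleAux_comm (l : List X) : ∀ f g : WordSeries K X,
    shuffleAux f g l = shuffleAux g f l := by
  induction l with
  | nil => intro f g; simp [shuffleAux, mul_comm]
  | cons a l ih => intro f g; simp only [shuffleAux]; rw [ih, ih f, add_comm]

/-- The shuffle product. -/
def shuffle : WordSeries K X →ₗ[K] WordSeries K X →ₗ[K] WordSeries K X :=
  LinearMap.mk₂ K (fun f g => shuffleAux f g)
    (fun f f' g => funext fun l => shuffleAux_add_left l f f' g)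
    (fun k f g => funext fun l => shuffleAux_smul_left l k f g)
    (fun f g g' => funext fun l => by
      change shuffleAux f (g + g') l = shuffleAux f g l + shuffleAux f g' l
      simp only [shuffleAux_comm l f, shuffleAux_add_left])
    (fun k f g => funext fun l => by
      change shuffleAux f (k • g) l = k * shuffleAux f g l
      simp only [shuffleAux_comm l f, shuffleAux_smul_left])

@[simp] theorem shuffle_nil (f g : WordSeries K X) : shuffle f g [] = f [] * g [] := rfl

theorem shuffle_cons (f g : WordSeries K X) (a : X) (l : List X) :
    shuffle f g (a :: l) = shuffle (der a f) g l + shuffle f (der a g) l := rfl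

theorem der_shuffle (f g : WordSeries K X) (a : X) :
    der a (shuffle f g) = shuffle (der a f) g + shuffle f (der a g) := rfl

theorem shuffle_comm (f g : WordSeries K X) : shuffle f g = shuffle g f :=
  funext fun l => shuffleAux_comm l f g

theorem shuffle_assoc (f g h : WordSeries K X) :
    shuffle (shuffle f g) h = shuffle f (shuffle g h) := by
  ext l
  induction l generalizing f g h with
  | nil => simp [mul_assoc]
  | cons a l ih =>
    simp only [shuffle_cons, der_shuffle, map_add, LinearMap.add_apply, add_apply, ih, add_assoc]

/-- The series obtained by deleting the constant term. -/
def augment : WordSeries K X →ₗ[K] WordSeries K X where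
  toFun f
    | [] => 0
    | a :: l => f (a :: l)
  map_add' f g := by
    ext l
    cases l with
    | nil => exact (add_zero 0).symm
    | cons a l => rfl
  map_smul' k f := by
    ext l
    cases l with
    | nil => exact (mul_zero k).symm
    | cons a l => rfl

@[simp] theorem augment_nil (f : WordSeries K X) : augment f [] = 0 := rfl
@[simp] theorem augment_cons (f : WordSeries K X) (a : X) (l : List X) :
    augment f (a :: l) = f (a :: l) := rfl

/-- The half-shuffle product. -/
instance : Mul (WordSeries K X) :=
  ⟨fun f g l => match l with
    | [] => 0
    | a :: l => shuffle (augment f) (der a g) l⟩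

@[simp] theorem mul_nil (f g : WordSeries K X) : (f * g) [] = 0 := rfl

theorem mul_cons (f g : WordSeries K X) (a : X) (l : List X) :
    (f * g) (a :: l) = shuffle (augment f) (der a g) l := rfl

theorem der_mul (f g : WordSeries K X) (a : X) :
    der a (f * g) = shuffle (augment f) (der a g) := rfl

theorem augment_mul (f g : WordSeries K X) : augment (f * g) = f * g := by
  ext l; cases l <;> rfl

instance : NonUnitalNonAssocRing (WordSeries K X) :=
  { (inferInstance : AddCommGroup (WordSeries K X)),
    (inferInstance : Mul (WordSeries K X)) with
    left_distrib := fun f g h => by ext l; cases l <;> simp [mul_cons]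
    right_distrib := fun f g h => by ext l; cases l <;> simp [mul_cons]
    zero_mul := fun f => by ext l; cases l <;> simp [mul_cons]
    mul_zero := fun f => by ext l; cases l <;> simp [mul_cons] }

instance : IsScalarTower K (WordSeries K X) (WordSeries K X) :=
  ⟨fun k f g => by ext l; cases l <;> simp [mul_cons]⟩

instance : SMulCommClass K (WordSeries K X) (WordSeries K X) :=
  ⟨fun k f g => by ext l; cases l <;> simp [mul_cons]⟩

/-- The first letter of a shuffled word comes from one factor or the other; the two half-shuffles
separate these cases. Constant terms must be removed, since they have no first letter. -/
theorem mul_add_mul (f g : WordSeries K X) :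
    f * g + g * f = shuffle (augment f) (augment g) := by
  ext l
  cases l with
  | nil => simp
  | cons a l =>
    rw [add_apply, mul_cons, mul_cons, shuffle_cons, shuffle_comm (augment g), add_comm]
    rfl

/-- After deletion of a first letter, both sides are triple shuffles, equal by associativity. -/
theorem isZinbiel : IsZinbiel (WordSeries K X) := by
  intro f g h
  ext l
  cases l with
  | nil => simp
  | cons a l =>
    rw [mul_cons, mul_cons, der_mul, map_add, augment_mul, augment_mul, mul_add_mul, shuffle_assoc]

theorem sum_apply {ι : Type*} (s : Finset ι) (f : ι → WordSeries K X) (l : List X) :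
    (∑ i ∈ s, f i) l = ∑ i ∈ s, f i l := Finset.sum_apply _ _ _

/-- The empty word. -/
def empty : WordSeries K X
  | [] => 1
  | _ :: _ => 0

@[simp] theorem der_empty (a : X) : der a (empty : WordSeries K X) = 0 := rfl

@[simp] theorem empty_shuffle (f : WordSeries K X) : shuffle empty f = f := by
  ext l
  induction l generalizing f with
  | nil => simp [empty]
  | cons a l ih => simp [shuffle_cons, ih]

/-- The part of a linear combination of words which starts with the letter `z`. -/
def slice (z : X) : (List X →₀ K) →ₗ[K] (List X →₀ K) :=
  Finsupp.lcomapDomain (List.cons z) (List.cons_injective)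

theorem slice_apply (z : X) (c : List X →₀ K) (l : List X) : slice z c l = c (z :: l) := rfl

/-! ### Independence of iterated right operators, by means of the Euler operator. -/

section Letter

variable [DecidableEq X]

/-- Left concatenation with a letter. -/
def cons (z : X) : WordSeries K X →ₗ[K] WordSeries K X where
  toFun f
    | [] => 0
    | a :: l => if a = z then f l else 0
  map_add' f g := by
    ext l
    cases l with
    | nil => exact (add_zero 0).symm
    | cons a l =>
      change (if a = z then f l + g l else 0) =
        (if a = z then f l else 0) + (if a = z then g l else 0)
      split_ifs <;> simp
  map_smul' k f := by
    ext l
    cases l with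
    | nil => exact (mul_zero k).symm
    | cons a l =>
      change (if a = z then k * f l else 0) = k * (if a = z then f l else 0)
      split_ifs <;> simp

@[simp] theorem cons_nil (z : X) (f : WordSeries K X) : cons z f [] = 0 := rfl
theorem cons_cons (z a : X) (f : WordSeries K X) (l : List X) :
    cons z f (a :: l) = if a = z then f l else 0 := rfl

theorem der_cons (z a : X) (f : WordSeries K X) :
    der a (cons z f) = if a = z then f else 0 := by
  ext l; rw [der_apply, cons_cons]; split_ifs <;> rfl

/-- The word consisting of the letter `z`. -/
def letter (z : X) : WordSeries K X := cons z empty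

theorem der_letter (z a : X) :
    der a (letter z : WordSeries K X) = if a = z then empty else 0 := der_cons z a _

@[simp] theorem letter_nil (z : X) : (letter z : WordSeries K X) [] = 0 := rfl

@[simp] theorem augment_letter (z : X) : augment (letter z : WordSeries K X) = letter z := by
  ext l; cases l <;> rfl

/-- The operator `f ↦ z ⧢ f + z f`. -/
def rightOp (z : X) : WordSeries K X →ₗ[K] WordSeries K X := shuffle (letter z) + cons z

theorem rightOp_apply (z : X) (f : WordSeries K X) :
    rightOp z f = shuffle (letter z) f + cons z f := rfl

/-- Words lengthen by at most one letter. Such bounds make the repeated derivatives in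
`iterEuler_eq_zero` vanish. -/
theorem rightOp_support (z : X) (n : ℕ) (f : WordSeries K X) (hf : ∀ l, n ≤ l.length → f l = 0)
    (l : List X) (hl : n + 1 ≤ l.length) : rightOp z f l = 0 := by
  have hsh : ∀ (l : List X) (n : ℕ) (f : WordSeries K X), (∀ l, n ≤ l.length → f l = 0) →
      n + 1 ≤ l.length → shuffle (letter z) f l = 0 := by
    intro l
    induction l with
    | nil => intro n f _ hl; simp at hl
    | cons a l ih =>
      intro n f hf hl
      rw [List.length_cons, Nat.add_le_add_iff_right] at hl
      rw [shuffle_cons, der_letter]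
      have h1 : shuffle (if a = z then empty else 0) f l = 0 := by
        split_ifs
        · rw [empty_shuffle, hf l hl]
        · simp
      rw [h1, zero_add]
      rcases n with _ | n
      · obtain rfl : f = 0 := by ext l; exact hf l (Nat.zero_le _)
        simp
      · exact ih n _ (fun l hl => hf _ (by simpa using hl)) hl
  rw [rightOp_apply, add_apply, hsh l n f hf hl]
  cases l with
  | nil => simp at hl
  | cons a l =>
    rw [cons_cons, hf l (by simpa using hl)]
    simp

/-- The series obtained from the empty word by applying the operators `rightOp z`. -/
def iterRightOp (l : List X) : WordSeries K X := l.foldr (fun z f => rightOp z f) empty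

theorem iterRightOp_support (l : List X) : ∀ l' : List X, l.length + 1 ≤ l'.length →
    (iterRightOp l : WordSeries K X) l' = 0 := by
  induction l with
  | nil =>
    intro l' hl'
    cases l' with
    | nil => simp at hl'
    | cons a l' => rfl
  | cons z l ih => exact rightOp_support z _ _ ih

theorem linearCombination_iterRightOp_support (n : ℕ) (c : List X →₀ K)
    (hc : ∀ l, n ≤ l.length → c l = 0) (l : List X) (hl : n ≤ l.length) :
    Finsupp.linearCombination K (iterRightOp : List X → WordSeries K X) c l = 0 := by
  rw [Finsupp.linearCombination_apply, Finsupp.sum, sum_apply]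
  refine Finset.sum_eq_zero fun l' hl' => ?_
  have h1 : l'.length < n := by
    by_contra h
    exact (Finsupp.mem_support_iff.1 hl') (hc l' (not_lt.1 h))
  rw [smul_apply, iterRightOp_support l' l (by omega), mul_zero]

variable [Fintype X]

/-- The Euler operator `∑ z ⧢ ∂_z`. -/
def euler : WordSeries K X →ₗ[K] WordSeries K X :=
  ∑ z, (shuffle (letter z)).comp (der z)

theorem euler_apply (f : WordSeries K X) : euler f = ∑ z, shuffle (letter z) (der z f) := by
  simp [euler]

/-- Each ∂_z is a derivation of the commutative shuffle algebra, hence so is any combination of them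
with shuffle coefficients. -/
theorem euler_shuffle (f g : WordSeries K X) :
    euler (shuffle f g) = shuffle (euler f) g + shuffle f (euler g) := by
  simp only [euler_apply, der_shuffle, map_add, Finset.sum_add_distrib, map_sum,
    LinearMap.sum_apply]
  congr 1
  · simp only [shuffle_assoc]
  · refine Finset.sum_congr rfl fun z _ => ?_
    rw [← shuffle_assoc, shuffle_comm (letter z), shuffle_assoc]

theorem euler_letter (z : X) : euler (letter z : WordSeries K X) = letter z := by
  rw [euler_apply, Finset.sum_eq_single z]
  · rw [der_letter, if_pos rfl, shuffle_comm, empty_shuffle]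
  · intro b _ hb
    rw [der_letter, if_neg hb, map_zero]
  · simp

/-- The operator `∑ g ⧢ z₁ ⧢ ⋯ ⧢ zₖ ⧢ ∂_{zₖ} ⋯ ∂_{z₁} f`. -/
def iterEuler : ℕ → WordSeries K X → WordSeries K X → WordSeries K X
  | 0, g, f => shuffle g f
  | k + 1, g, f => ∑ z, iterEuler k (shuffle g (letter z)) (der z f)

/-- The Euler operator is a derivation fixing letters, so g ⧢ z₁ ⧢ ⋯ ⧢ zₖ is an eigenvector with
eigenvalue k + d; differentiating the last factor gives the next iterate. General d is needed
because the recursion absorbs letters into g. -/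
theorem euler_iterEuler (k : ℕ) : ∀ (d : K) (g f : WordSeries K X), euler g = d • g →
    euler (iterEuler k g f) = iterEuler (k + 1) g f + (k + d) • iterEuler k g f := by
  induction k with
  | zero =>
    intro d g f hg
    simp only [iterEuler]
    rw [euler_shuffle, hg, euler_apply, map_sum, map_smul, LinearMap.smul_apply, Nat.cast_zero,
      zero_add, add_comm]
    simp only [shuffle_assoc]
  | succ k ih =>
    intro d g f hg
    rw [iterEuler, map_sum, iterEuler, Finset.smul_sum, ← Finset.sum_add_distrib]
    refine Finset.sum_congr rfl fun z _ => ?_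
    rw [ih (d + 1)]
    · push_cast
      congr 2; ring
    · rw [euler_shuffle, hg, euler_letter, add_smul, one_smul, map_smul, LinearMap.smul_apply]

theorem iterEuler_zero_right (k : ℕ) : ∀ g : WordSeries K X, iterEuler k g 0 = 0 := by
  induction k with
  | zero => intro g; simp [iterEuler]
  | succ k ih => intro g; simp [iterEuler, ih]

theorem iterEuler_eq_zero (k : ℕ) : ∀ g f : WordSeries K X, (∀ l, k ≤ l.length → f l = 0) →
    iterEuler k g f = 0 := by
  induction k with
  | zero =>
    intro g f hf
    obtain rfl : f = 0 := by ext l; exact hf l (Nat.zero_le _)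
    exact iterEuler_zero_right 0 g
  | succ k ih =>
    intro g f hf
    rw [iterEuler]
    exact Finset.sum_eq_zero fun z _ => ih _ _ fun l hl => hf _ (by simpa using hl)

/-- If E f = -f, the recursion of `euler_iterEuler` makes the k-th iterate equal to (-1)^k k! f, a
nonzero multiple of f in characteristic 0. Yet the n-th iterate vanishes, because it takes n
derivatives of f. -/
theorem eq_zero_of_euler_add_self [CharZero K] (n : ℕ) (f : WordSeries K X)
    (hn : ∀ l, n ≤ l.length → f l = 0) (hf : euler f + f = 0) : f = 0 := by
  have key : ∀ k, ∃ c : K, c ≠ 0 ∧ iterEuler k empty f = c • f := by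
    intro k
    induction k with
    | zero => exact ⟨1, one_ne_zero, by simp [iterEuler]⟩
    | succ k ih =>
      obtain ⟨c, hc, hk⟩ := ih
      -- With d = 0, the next iterate is (E - k)(c f) = -(k + 1)c f.
      refine ⟨-((k + 1) * c), neg_ne_zero.2 (mul_ne_zero (Nat.cast_add_one_ne_zero k) hc), ?_⟩
      have h := euler_iterEuler k (0 : K) empty f (by simp [euler_apply])
      rw [hk, map_smul, eq_neg_of_add_eq_zero_left hf, add_zero] at h
      rw [eq_sub_of_add_eq h.symm, smul_smul, smul_neg, neg_smul, add_mul, add_smul, one_mul]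
      abel
  obtain ⟨c, hc, h⟩ := key n
  rw [iterEuler_eq_zero n _ _ hn] at h
  exact (smul_eq_zero.1 h.symm).resolve_left hc

/-- ∂_a sends ∑ z f_z to f_a, so the shuffle parts of the operators add up to the Euler operator. -/
theorem sum_rightOp (f : X → WordSeries K X) :
    ∑ z, rightOp z (f z) = euler (∑ z, cons z (f z)) + ∑ z, cons z (f z) := by
  simp only [rightOp_apply, Finset.sum_add_distrib]
  congr 1
  rw [euler_apply]
  refine Finset.sum_congr rfl fun z _ => ?_
  congr 1
  simp [map_sum, der_cons]

theorem eq_zero_of_sum_rightOp [CharZero K] (n : ℕ) (f : X → WordSeries K X)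
    (hn : ∀ z l, n ≤ l.length → f z l = 0) (h : ∑ z, rightOp z (f z) = 0) (z : X) : f z = 0 := by
  have h1 : ∑ z, cons z (f z) = 0 := by
    refine eq_zero_of_euler_add_self (n + 1) _ ?_ (by rw [← sum_rightOp, h])
    intro l hl
    cases l with
    | nil => simp at hl
    | cons a l =>
      have : der a (∑ z, cons z (f z)) = f a := by simp [map_sum, der_cons]
      exact (congrFun this l).trans (hn _ _ (by simpa using hl))
  have h2 := congrArg (der z) h1
  simpa [map_sum, der_cons] using h2

/-- Grouping by first letter isolates the outermost operator, which allows induction on word length.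
-/
theorem linearCombination_iterRightOp (c : List X →₀ K) :
    Finsupp.linearCombination K (iterRightOp : List X → WordSeries K X) c =
      c [] • empty + ∑ z, rightOp z (Finsupp.linearCombination K iterRightOp (slice z c)) := by
  induction c using Finsupp.induction_linear with
  | zero => simp
  | add c d hc hd =>
    simp only [map_add, Finsupp.add_apply, add_smul, Finset.sum_add_distrib, hc, hd]
    abel
  | single l k =>
    cases l with
    | nil =>
      have h : ∀ z : X, slice z (Finsupp.single [] k) = 0 := fun z => by
        ext l; simp [slice_apply]
      simp [h, iterRightOp]
    | cons a l =>
      have h : ∀ z : X, slice z (Finsupp.single (a :: l) k) =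
          if z = a then Finsupp.single l k else 0 := fun z => by
        ext l'
        rw [slice_apply, Finsupp.single_apply]
        by_cases hz : z = a
        · simp [hz, Finsupp.single_apply]
        · simp [hz, Ne.symm hz]
      rw [Finset.sum_eq_single a (fun z _ hz => by rw [h, if_neg hz, map_zero, map_zero])
        (by simp), h, if_pos rfl]
      simp [iterRightOp]

theorem linearIndependent_iterRightOp [CharZero K] :
    LinearIndependent K (iterRightOp : List X → WordSeries K X) := by
  have key : ∀ (n : ℕ) (c : List X →₀ K), (∀ l, n ≤ l.length → c l = 0) →
      Finsupp.linearCombination K (iterRightOp : List X → WordSeries K X) c = 0 → c = 0 := by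
    intro n
    induction n with
    | zero =>
      intro c hc _
      ext l
      exact hc l (Nat.zero_le _)
    | succ n ih =>
      intro c hc h
      have hs : ∀ z l, n ≤ l.length → slice z c l = 0 := fun z l hl =>
        hc _ (by simpa using hl)
      rw [linearCombination_iterRightOp] at h
      -- Every `rightOp z` has zero constant term, so only the empty word contributes here.
      have h0 : c [] = 0 := by
        have := congrFun h []
        rw [add_apply, sum_apply] at this
        simpa [rightOp_apply, empty] using this
      rw [h0, zero_smul, zero_add] at h
      have h1 := fun z => ih _ (hs z) (eq_zero_of_sum_rightOp n _
        (fun z => linearCombination_iterRightOp_support n _ (hs z)) h z)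
      ext l
      cases l with
      | nil => exact h0
      | cons a l => exact DFunLike.congr_fun (h1 a) l
  rw [linearIndependent_iff]
  intro c hc
  refine key (c.support.sup List.length + 1) c (fun l hl => ?_) hc
  by_contra h
  have := Finset.le_sup (f := List.length) (Finsupp.mem_support_iff.2 h)
  omega

end Letter

/-- The series `(y x - x y) f`, where `x` and `y` are the letters `0` and `1`. -/
def bracketCons : WordSeries K (Fin 2) →ₗ[K] WordSeries K (Fin 2) :=
  (cons 1).comp (cons 0) - (cons 0).comp (cons 1)

theorem bracketCons_apply (f : WordSeries K (Fin 2)) :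
    bracketCons f = cons 1 (cons 0 f) - cons 0 (cons 1 f) := rfl

theorem bracketCons_injective :
    Function.Injective (bracketCons : WordSeries K (Fin 2) →ₗ[K] WordSeries K (Fin 2)) := by
  intro f g h
  have h1 := congrArg (fun t => der 0 (der 1 t)) h
  simpa [bracketCons_apply, der_cons] using h1

/-- The half-shuffle puts the first letter of the right factor in front: x * y is the word yx. -/
theorem letter_bracket :
    (letter 0 * letter 1 - letter 1 * letter 0 : WordSeries K (Fin 2)) = bracketCons empty := by
  ext l
  rcases l with _ | ⟨a, l⟩
  · simp [bracketCons_apply]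
  · rw [sub_apply, mul_cons, mul_cons, bracketCons_apply, sub_apply, cons_cons, cons_cons,
      augment_letter, augment_letter, der_letter, der_letter, shuffle_comm, shuffle_comm (letter 1)]
    fin_cases a <;> simp <;> rfl

/-- With u = yx - xy, the bracket is zuf - (y(z ⧢ xf) - x(z ⧢ yf)). Expanding the shuffles leaves
-u(z ⧢ f) plus words in which z stands before or inside u; since z is x or y, these collapse to
-uzf. -/
theorem bracketCons_bracket (f : WordSeries K (Fin 2)) (z : Fin 2) :
    bracketCons f * letter z - letter z * bracketCons f = -bracketCons (rightOp z f) := by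
  have haug : augment (bracketCons f) = bracketCons f := by
    ext l; cases l <;> simp [bracketCons_apply]
  ext l
  rcases l with _ | ⟨a, l⟩
  · simp [bracketCons_apply]
  rw [sub_apply, mul_cons, mul_cons, haug, augment_letter, der_letter, neg_apply]
  rcases l with _ | ⟨b, l⟩
  · fin_cases a <;> fin_cases z <;> simp [bracketCons_apply, cons_cons, empty]
  rw [shuffle_cons (letter z), der_letter, shuffle_comm _ (ite _ _ _)]
  fin_cases a <;> fin_cases b <;> fin_cases z <;> cases l <;>
    simp [bracketCons_apply, cons_cons, der_cons, rightOp_apply, add_comm, sub_eq_add_neg]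

end WordSeries

end ShuffleAlgebra
-- Universal properties, spanning, independence, and the canonical map from T to ST.
noncomputable section FreeAlgebras

namespace PresentedAlgebra

variable {K : Type u} [Field K] {X : Type v} {S : Set (FreeNonUnitalNonAssocAlgebra K X)}

/-- A homomorphism from the free algebra which kills the relators descends to the quotient. -/
def lift {B : Type*} [NonUnitalNonAssocRing B] [Module K B]
    (f : FreeNonUnitalNonAssocAlgebra K X →ₙₐ[K] B) (hf : ∀ s ∈ S, f s = 0) :
    PresentedAlgebra K S →ₙₐ[K] B :=
  let N : Submodule K (FreeNonUnitalNonAssocAlgebra K X) := LinearMap.ker (f : _ →ₗ[K] B)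
  have hN : relatorIdeal K S ≤ N := sInf_le ⟨fun s hs => LinearMap.mem_ker.2 (hf s hs), fun a n hn => by
    have hn' : f n = 0 := hn
    constructor
    · change f (a * n) = 0
      rw [map_mul, hn', mul_zero]
    · change f (n * a) = 0
      rw [map_mul, hn', zero_mul]⟩
  let g : PresentedAlgebra K S →ₗ[K] B := (relatorIdeal K S).liftQ (f : _ →ₗ[K] B) hN
  { g with
    map_zero' := map_zero g
    map_mul' := fun a b => by
      obtain ⟨a, rfl⟩ := mk_surjective K S a
      obtain ⟨b, rfl⟩ := mk_surjective K S b
      exact map_mul f a b }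

theorem mk_eq_zero {a : FreeNonUnitalNonAssocAlgebra K X} (ha : a ∈ S) : mk K S a = 0 :=
  (Submodule.Quotient.mk_eq_zero _).2 (subset_relatorIdeal K S ha)

end PresentedAlgebra

open PresentedAlgebra

variable {K : Type u} [Field K] {X : Type v}

theorem map_jacobian {A B : Type*} [NonUnitalNonAssocRing A] [NonUnitalNonAssocRing B]
    {F : Type*} [FunLike F A B] [NonUnitalRingHomClass F A B] (f : F) (a b c : A) :
    f (jacobian a b c) = jacobian (f a) (f b) (f c) := by
  simp only [jacobian, map_add, map_mul]

theorem isZinbiel_freeZinbiel : IsZinbiel (FreeZinbiel K X) := by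
  intro a b c
  obtain ⟨a, rfl⟩ := mk_surjective K _ a
  obtain ⟨b, rfl⟩ := mk_surjective K _ b
  obtain ⟨c, rfl⟩ := mk_surjective K _ c
  have h := mk_eq_zero (K := K) (S := zinbielRelators K X) ⟨a, b, c, rfl⟩
  rw [map_sub, sub_eq_zero] at h
  simpa only [mk_mul, map_add] using h

theorem isTortkara_freeTortkara : IsTortkara (FreeTortkara K X) := by
  constructor
  · intro a b
    obtain ⟨a, rfl⟩ := mk_surjective K _ a
    obtain ⟨b, rfl⟩ := mk_surjective K _ b
    have h := mk_eq_zero (K := K) (S := tortkaraRelators K X) (Or.inl ⟨a, b, rfl⟩)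
    rw [map_add, mk_mul, mk_mul] at h
    exact eq_neg_of_add_eq_zero_left h
  · intro a b c
    obtain ⟨a, rfl⟩ := mk_surjective K _ a
    obtain ⟨b, rfl⟩ := mk_surjective K _ b
    obtain ⟨c, rfl⟩ := mk_surjective K _ c
    have h := mk_eq_zero (K := K) (S := tortkaraRelators K X) (Or.inr ⟨a, b, c, rfl⟩)
    rw [map_sub, sub_eq_zero] at h
    simpa only [mk_mul, map_add, jacobian] using h

section Lift

variable {B : Type*} [NonUnitalNonAssocRing B] [Module K B] [IsScalarTower K B B]
  [SMulCommClass K B B]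

/-- The universal property of the free Zinbiel algebra. -/
def FreeZinbiel.lift (hB : IsZinbiel B) (f : X → B) : FreeZinbiel K X →ₙₐ[K] B :=
  PresentedAlgebra.lift (FreeNonUnitalNonAssocAlgebra.lift K f) (by
    rintro _ ⟨a, b, c, rfl⟩
    simp only [map_sub, map_mul, map_add]
    rw [hB, sub_self])

theorem FreeZinbiel.lift_of (hB : IsZinbiel B) (f : X → B) (x : X) :
    FreeZinbiel.lift (K := K) hB f (PresentedAlgebra.of K _ x) = f x :=
  FreeNonUnitalNonAssocAlgebra.lift_of_apply K f x

/-- The universal property of the free Tortkara algebra. -/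
def FreeTortkara.lift (hB : IsTortkara B) (f : X → B) : FreeTortkara K X →ₙₐ[K] B :=
  PresentedAlgebra.lift (FreeNonUnitalNonAssocAlgebra.lift K f) (by
    rintro _ (⟨a, b, rfl⟩ | ⟨a, b, c, rfl⟩)
    · simp only [map_mul, map_add]
      rw [hB.1, neg_add_cancel]
    · simp only [map_sub, map_mul, map_jacobian]
      rw [hB.2, sub_self])

theorem FreeTortkara.lift_of (hB : IsTortkara B) (f : X → B) (x : X) :
    FreeTortkara.lift (K := K) hB f (FreeTortkara.of K x) = f x :=
  FreeNonUnitalNonAssocAlgebra.lift_of_apply K f x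

end Lift

/-! ### Left-normed monomials span -/

variable (K) in
/-- The span of the left-normed monomials of degree `p + 1`. -/
def leftNormedSpan (X : Type v) (p : ℕ) : Submodule K (FreeTortkara K X) :=
  Submodule.span K {t | ∃ (i : X) (l : List X), l.length = p ∧ t = leftNormed K i l}

theorem leftNormed_mem_leftNormedSpan (i : X) (l : List X) :
    leftNormed K i l ∈ leftNormedSpan K X l.length := Submodule.subset_span ⟨i, l, rfl, rfl⟩

theorem leftNormed_append (i : X) (l : List X) (z : X) :
    leftNormed K i (l ++ [z]) = leftNormed K i l * FreeTortkara.of K z := by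
  simp [leftNormed]

theorem mul_of_mem_leftNormedSpan (z : X) (p : ℕ) (a : FreeTortkara K X)
    (ha : a ∈ leftNormedSpan K X p) : a * FreeTortkara.of K z ∈ leftNormedSpan K X (p + 1) := by
  induction ha using Submodule.span_induction with
  | mem a ha =>
    obtain ⟨i, l, rfl, rfl⟩ := ha
    rw [← leftNormed_append]
    exact Submodule.subset_span ⟨i, l ++ [z], by simp, rfl⟩
  | zero => rw [zero_mul]; exact zero_mem _
  | add a b _ _ ha hb => rw [add_mul]; exact add_mem ha hb
  | smul k a _ ha => rw [smul_mul_assoc]; exact Submodule.smul_mem _ _ ha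

theorem exists_of_mem_leftNormedSpan_zero (a : FreeTortkara K (Fin 2))
    (ha : a ∈ leftNormedSpan K (Fin 2) 0) :
    ∃ c d : K, a = c • FreeTortkara.of K 0 + d • FreeTortkara.of K 1 := by
  have h : a ∈ Submodule.span K {FreeTortkara.of K (0 : Fin 2), FreeTortkara.of K 1} := by
    refine Submodule.span_le.2 ?_ ha
    rintro _ ⟨i, l, hl, rfl⟩
    obtain rfl := List.eq_nil_of_length_eq_zero hl
    apply Submodule.subset_span
    fin_cases i
    · exact Or.inl rfl
    · exact Or.inr rfl
  obtain ⟨c, d, h⟩ := Submodule.mem_span_pair.1 h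
  exact ⟨c, d, h.symm⟩

theorem exists_of_mem_leftNormedSpan_succ (p : ℕ) (a : FreeTortkara K (Fin 2))
    (ha : a ∈ leftNormedSpan K (Fin 2) (p + 1)) :
    ∃ b ∈ leftNormedSpan K (Fin 2) p, ∃ c ∈ leftNormedSpan K (Fin 2) p,
      a = b * FreeTortkara.of K 0 + c * FreeTortkara.of K 1 := by
  induction ha using Submodule.span_induction with
  | mem a ha =>
    obtain ⟨i, l, hl, rfl⟩ := ha
    rcases List.eq_nil_or_concat l with rfl | ⟨l, z, rfl⟩
    · simp at hl
    have hl' : l.length = p := by simpa using hl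
    subst hl'
    rw [List.concat_eq_append, leftNormed_append]
    fin_cases z
    · exact ⟨_, leftNormed_mem_leftNormedSpan i l, 0, zero_mem _, by simp⟩
    · exact ⟨0, zero_mem _, _, leftNormed_mem_leftNormedSpan i l, by simp⟩
  | zero => exact ⟨0, zero_mem _, 0, zero_mem _, by simp⟩
  | add a a' _ _ ha ha' =>
    obtain ⟨b, hb, c, hc, rfl⟩ := ha
    obtain ⟨b', hb', c', hc', rfl⟩ := ha'
    exact ⟨b + b', add_mem hb hb', c + c', add_mem hc hc', by rw [add_mul, add_mul]; abel⟩
  | smul k a _ ha =>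
    obtain ⟨b, hb, c, hc, rfl⟩ := ha
    exact ⟨k • b, Submodule.smul_mem _ _ hb, k • c, Submodule.smul_mem _ _ hc, by
      rw [smul_add, smul_mul_assoc, smul_mul_assoc]⟩

theorem mul_mem_leftNormedSpan [CharZero K] (p q : ℕ) (a b : FreeTortkara K (Fin 2))
    (ha : a ∈ leftNormedSpan K (Fin 2) p) (hb : b ∈ leftNormedSpan K (Fin 2) q) :
    a * b ∈ leftNormedSpan K (Fin 2) (p + q + 1) :=
  isTortkara_freeTortkara.mul_mem_of_leftNormed (isTortkara_freeTortkara.mul_self K)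
    (leftNormed_mem_leftNormedSpan 0 []) (leftNormed_mem_leftNormedSpan 1 [])
    exists_of_mem_leftNormedSpan_zero exists_of_mem_leftNormedSpan_succ
    (mul_of_mem_leftNormedSpan 0) (mul_of_mem_leftNormedSpan 1) (p + q) p q rfl a ha b hb

variable (K) in
/-- The image in the free Tortkara algebra of a nonassociative monomial. -/
def tortkaraMonomial (w : FreeMagma X) : FreeTortkara K X :=
  mk K (tortkaraRelators K X) (MonoidAlgebra.ofMagma K (FreeMagma X) w)

theorem tortkaraMonomial_mul (w w' : FreeMagma X) :
    tortkaraMonomial K (w * w') = tortkaraMonomial K w * tortkaraMonomial K w' := by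
  rw [tortkaraMonomial, map_mul]
  exact mk_mul K _ _ _

theorem tortkaraMonomial_of (x : X) :
    tortkaraMonomial K (FreeMagma.of x) = FreeTortkara.of K x := rfl

/-- Any bracketing is left-normed up to linear combination, by multiplicativity of the spans. The
spans are indexed by degree minus one, and lengths are positive, so the subtraction is exact. -/
theorem tortkaraMonomial_mem [CharZero K] (w : FreeMagma (Fin 2)) :
    tortkaraMonomial K w ∈ leftNormedSpan K (Fin 2) (w.length - 1) := by
  induction w with
  | ih1 x => exact leftNormed_mem_leftNormedSpan x []
  | ih2 w w' hw hw' =>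
    rw [tortkaraMonomial_mul]
    have h := mul_mem_leftNormedSpan _ _ _ _ hw hw'
    have h1 := w.length_pos
    have h2 := w'.length_pos
    convert h using 2
    change w.length + w'.length - 1 = _
    omega

theorem exists_leftNormed_eq_tortkaraMonomial (i : X) (l : List X) :
    ∃ w : FreeMagma X, w.length = l.length + 1 ∧ leftNormed K i l = tortkaraMonomial K w := by
  induction l using List.reverseRecOn with
  | nil => exact ⟨FreeMagma.of i, rfl, rfl⟩
  | append_singleton l z ih =>
    obtain ⟨w, hw, h⟩ := ih
    refine ⟨w * FreeMagma.of z, ?_, ?_⟩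
    · change w.length + 1 = _
      simp [hw]
    · rw [leftNormed_append, h, tortkaraMonomial_mul, tortkaraMonomial_of]

theorem homogeneousComponent_eq_span_leftNormed [CharZero K] (n : ℕ) :
    homogeneousComponent K (Fin 2) n =
      Submodule.span K {t | ∃ (i : Fin 2) (l : List (Fin 2)),
        l.length + 1 = n ∧ t = leftNormed K i l} := by
  apply le_antisymm
  · refine Submodule.span_le.2 ?_
    rintro _ ⟨w, rfl, rfl⟩
    have h := w.length_pos
    refine Submodule.span_mono ?_ (tortkaraMonomial_mem (K := K) w)
    rintro _ ⟨i, l, hl, rfl⟩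
    exact ⟨i, l, by omega, rfl⟩
  · refine Submodule.span_le.2 ?_
    rintro _ ⟨i, l, rfl, rfl⟩
    obtain ⟨w, hw, h⟩ := exists_leftNormed_eq_tortkaraMonomial (K := K) i l
    exact Submodule.subset_span ⟨w, hw, h⟩

theorem span_tortkaraMonomial :
    Submodule.span K (Set.range (tortkaraMonomial K : FreeMagma X → FreeTortkara K X)) = ⊤ := by
  refine eq_top_iff.2 fun t _ => ?_
  obtain ⟨a, rfl⟩ := mk_surjective K _ t
  induction a using MonoidAlgebra.induction_linear with
  | zero => rw [map_zero]; exact zero_mem _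
  | add a b ha hb => rw [map_add]; exact add_mem (ha trivial) (hb trivial)
  | single w k =>
    have h : (MonoidAlgebra.single w k : MonoidAlgebra K (FreeMagma X)) =
        k • MonoidAlgebra.ofMagma K (FreeMagma X) w := by simp
    rw [h]
    erw [map_smul]
    exact Submodule.smul_mem _ _ (Submodule.subset_span ⟨w, rfl⟩)

/-- Only the first two letters matter: equal letters give zero and the order 1, 0 gives a sign, both
of which persist under right multiplication. -/
theorem span_leftNormedFamily [CharZero K] :
    Submodule.span K (Set.range (leftNormedFamily K)) = ⊤ := by
  rw [eq_top_iff, ← span_tortkaraMonomial, Submodule.span_le]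
  rintro _ ⟨w, rfl⟩
  refine Submodule.span_le.2 ?_ (tortkaraMonomial_mem (K := K) w)
  rintro _ ⟨i, l, -, rfl⟩
  have hT : IsTortkara (FreeTortkara K (Fin 2)) := isTortkara_freeTortkara
  have hbase : ∀ (a : FreeTortkara K (Fin 2)) (l : List (Fin 2)),
      l.foldl (fun a z => a * FreeTortkara.of K z) (-a) =
        -l.foldl (fun a z => a * FreeTortkara.of K z) a := by
    intro a l
    induction l generalizing a with
    | nil => rfl
    | cons z l ih => rw [List.foldl_cons, neg_mul, ih, List.foldl_cons]
  have hzero : ∀ l : List (Fin 2),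
      l.foldl (fun a z => a * FreeTortkara.of K z) (0 : FreeTortkara K (Fin 2)) = 0 := by
    intro l
    induction l with
    | nil => rfl
    | cons z l ih => rw [List.foldl_cons, zero_mul, ih]
  rcases l with _ | ⟨j, l⟩
  · exact Submodule.subset_span ⟨Sum.inl i, rfl⟩
  have hmem : leftNormed K 0 (1 :: l) ∈ Submodule.span K (Set.range (leftNormedFamily K)) :=
    Submodule.subset_span ⟨Sum.inr l, rfl⟩
  have hself : ∀ i : Fin 2, leftNormed K i (i :: l) = 0 := fun i => by
    rw [leftNormed, List.foldl_cons, hT.mul_self K, hzero]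
  have hneg : leftNormed K (1 : Fin 2) (0 :: l) = -leftNormed K 0 (1 :: l) := by
    rw [leftNormed, List.foldl_cons, hT.1, hbase]; rfl
  fin_cases i <;> fin_cases j
  · exact (hself 0).symm ▸ zero_mem _
  · exact hmem
  · exact hneg.symm ▸ neg_mem hmem
  · exact (hself 1).symm ▸ zero_mem _

/-! ### Independence -/

/-- Functoriality of the commutator algebra. -/
def MinusAlgebra.map {A B : Type*} [NonUnitalNonAssocRing A] [Module K A]
    [NonUnitalNonAssocRing B] [Module K B] (f : A →ₙₐ[K] B) :
    MinusAlgebra A →ₙₐ[K] MinusAlgebra B where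
  toFun a := MinusAlgebra.of (f a.out)
  map_smul' k a := map_smul f k a.out
  map_zero' := map_zero f
  map_add' a b := map_add f a.out b.out
  map_mul' a b := by
    change f (a.out * b.out - b.out * a.out) = f a.out * f b.out - f b.out * f a.out
    rw [map_sub, map_mul, map_mul]

-- Each further letter applies `-rightOp` under `bracketCons`. The last letter acts outermost,
-- whence the reversed list.
open WordSeries in
theorem linearIndependent_of_leftNormedFamily [CharZero K]
    (φ : FreeTortkara K (Fin 2) →ₙₐ[K] MinusAlgebra (WordSeries K (Fin 2)))
    (hφ : ∀ i, φ (FreeTortkara.of K i) = MinusAlgebra.of (letter i)) :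
    LinearIndependent K (fun j => φ (leftNormedFamily K j)) := by
  have hmul : ∀ a b : WordSeries K (Fin 2), MinusAlgebra.of a * MinusAlgebra.of b =
      MinusAlgebra.of (a * b - b * a) := fun _ _ => rfl
  have h1 : ∀ l, φ (leftNormed K 0 (1 :: l)) =
      MinusAlgebra.of ((-1 : Kˣ) ^ l.length • bracketCons (iterRightOp l.reverse)) := by
    intro l
    induction l using List.reverseRecOn with
    | nil =>
      change φ (FreeTortkara.of K 0 * FreeTortkara.of K 1) = _
      rw [map_mul, hφ, hφ, hmul, letter_bracket, List.length_nil, pow_zero, one_smul]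
      rfl
    | append_singleton l z ih =>
      rw [← List.cons_append, leftNormed_append, map_mul, ih, hφ, hmul, Units.smul_def,
        Units.smul_def, smul_mul_assoc, mul_smul_comm, ← smul_sub, bracketCons_bracket,
        List.reverse_append, List.length_append, List.length_singleton, pow_succ]
      simp [iterRightOp]
  have h2 : LinearIndependent K (letter : Fin 2 → WordSeries K (Fin 2)) := by
    rw [Fintype.linearIndependent_iff]
    intro c hc i
    have := congrFun hc [i]
    rw [WordSeries.sum_apply] at this
    fin_cases i <;> simpa [letter, cons_cons, empty] using this
  have h3 : LinearIndependent K (fun l : List (Fin 2) => (-1 : Kˣ) ^ l.length •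
      bracketCons (iterRightOp l.reverse : WordSeries K (Fin 2))) :=
    ((linearIndependent_iterRightOp.comp _ List.reverse_injective).map' bracketCons
      (LinearMap.ker_eq_bot.2 bracketCons_injective)).units_smul _
  -- Multiples of yx - xy have no words of length one, so the coefficients at `[i]` separate them
  -- from the letters.
  have h4 := h2.sum_type h3 (by
    rw [Submodule.disjoint_def]
    intro f hf hf'
    obtain ⟨c, rfl⟩ := (Submodule.mem_span_range_iff_exists_fun K).1 hf
    have h5 : Submodule.span K (Set.range fun l : List (Fin 2) => (-1 : Kˣ) ^ l.length •
        bracketCons (iterRightOp l.reverse : WordSeries K (Fin 2))) ≤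
          LinearMap.range bracketCons := by
      rw [Submodule.span_le]
      rintro _ ⟨l, rfl⟩
      exact Submodule.smul_mem _ _ ⟨_, rfl⟩
    obtain ⟨g, hg⟩ := h5 hf'
    refine Finset.sum_eq_zero fun i _ => ?_
    have := congrFun hg [i]
    rw [WordSeries.sum_apply] at this
    have hci : c i = 0 := by
      fin_cases i <;> simpa [letter, cons_cons, empty, bracketCons_apply] using this.symm
    rw [hci, zero_smul])
  have h6 : (fun j => φ (leftNormedFamily K j)) = fun j => MinusAlgebra.of (Sum.elim letter
      (fun l : List (Fin 2) => (-1 : Kˣ) ^ l.length •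
        bracketCons (iterRightOp l.reverse : WordSeries K (Fin 2))) j) := by
    funext j
    rcases j with i | l
    · exact hφ i
    · exact h1 l
  rw [h6]
  exact h4

/-- The canonical homomorphism `T(X) → ST(X)`. -/
def FreeTortkara.toSpecial : FreeTortkara K X →ₙₐ[K] freeSpecialTortkara K X :=
  FreeTortkara.lift (by
    have h : IsTortkara (MinusAlgebra (FreeZinbiel K X)) :=
      isZinbiel_freeZinbiel.isTortkara_minusAlgebra
    exact ⟨fun a b => Subtype.ext (h.1 a b), fun a b c => Subtype.ext (h.2 a b c)⟩)
    (freeSpecialTortkara.of K)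

theorem FreeTortkara.toSpecial_of (x : X) :
    toSpecial (FreeTortkara.of K x) = freeSpecialTortkara.of K x := FreeTortkara.lift_of _ _ _

theorem FreeTortkara.toSpecial_surjective :
    Function.Surjective (toSpecial : FreeTortkara K X →ₙₐ[K] freeSpecialTortkara K X) := by
  rintro ⟨a, ha⟩
  refine NonUnitalAlgebra.adjoin_induction (p := fun a ha => ∃ t : FreeTortkara K X,
    toSpecial t = (⟨a, ha⟩ : freeSpecialTortkara K X)) ?_ ?_ ?_ ?_ ?_ ha
  · rintro _ ⟨x, rfl⟩
    exact ⟨FreeTortkara.of K x, toSpecial_of x⟩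
  · rintro _ _ _ _ ⟨s, hs⟩ ⟨t, ht⟩
    exact ⟨s + t, by rw [map_add, hs, ht]; rfl⟩
  · exact ⟨0, map_zero _⟩
  · rintro _ _ _ _ ⟨s, hs⟩ ⟨t, ht⟩
    exact ⟨s * t, by rw [map_mul, hs, ht]; rfl⟩
  · rintro k _ _ ⟨t, ht⟩
    exact ⟨k • t, by rw [map_smul, ht]; rfl⟩

/-- The factorization through `toSpecial` lets one independence statement serve both for the basis
and for injectivity of `toSpecial`. -/
theorem exists_linearIndependent_factor [CharZero K] :
    ∃ f : FreeTortkara K (Fin 2) →ₗ[K] MinusAlgebra (WordSeries K (Fin 2)),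
      (∀ a b, FreeTortkara.toSpecial a = FreeTortkara.toSpecial b → f a = f b) ∧
      LinearIndependent K (f ∘ leftNormedFamily K) := by
  obtain ⟨ψ, hψ⟩ : ∃ ψ : freeSpecialTortkara K (Fin 2) →ₙₐ[K]
      MinusAlgebra (WordSeries K (Fin 2)),
      ∀ i, ψ (freeSpecialTortkara.of K i) = MinusAlgebra.of (WordSeries.letter i) :=
    ⟨(MinusAlgebra.map (FreeZinbiel.lift (K := K)
      (WordSeries.isZinbiel (K := K) (X := Fin 2)) WordSeries.letter)).comp
        (NonUnitalSubalgebraClass.subtype (freeSpecialTortkara K (Fin 2))),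
      fun i => FreeZinbiel.lift_of (K := K)
        (WordSeries.isZinbiel (K := K) (X := Fin 2)) WordSeries.letter i⟩
  obtain ⟨φ, hφ⟩ : ∃ φ : FreeTortkara K (Fin 2) →ₙₐ[K] MinusAlgebra (WordSeries K (Fin 2)),
      ∀ a, φ a = ψ (FreeTortkara.toSpecial a) :=
    ⟨ψ.comp FreeTortkara.toSpecial, fun _ => rfl⟩
  have hli := linearIndependent_of_leftNormedFamily φ fun i => by
    rw [hφ, FreeTortkara.toSpecial_of, hψ]
  refine ⟨{ toFun := φ, map_add' := map_add φ, map_smul' := map_smul φ }, fun a b hab => ?_, hli⟩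
  change φ a = φ b
  rw [hφ, hφ, hab]

theorem linearIndependent_leftNormedFamily [CharZero K] :
    LinearIndependent K (leftNormedFamily K) := by
  obtain ⟨f, -, hf⟩ := exists_linearIndependent_factor (K := K)
  exact LinearIndependent.of_comp f hf

/-- The basis of `T({x, y})` formed by the left-normed elements. -/
def leftNormedBasis (K : Type u) [Field K] [CharZero K] :
    Module.Basis (Fin 2 ⊕ List (Fin 2)) K (FreeTortkara K (Fin 2)) :=
  Module.Basis.mk linearIndependent_leftNormedFamily span_leftNormedFamily.ge

theorem FreeTortkara.toSpecial_injective [CharZero K] :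
    Function.Injective
      (toSpecial : FreeTortkara K (Fin 2) →ₙₐ[K] freeSpecialTortkara K (Fin 2)) := by
  obtain ⟨f, hf, hli⟩ := exists_linearIndependent_factor (K := K)
  exact fun a b hab =>
    LinearMap.injective_of_linearIndependent span_leftNormedFamily hli (hf a b hab)

end FreeAlgebras

theorem mainTheorem3 (K : Type u) [Field K] [CharZero K] :
    IsSpecialTortkara K (FreeTortkara K (Fin 2)) ∧
    (∃ φ : FreeTortkara K (Fin 2) →ₙₐ[K] freeSpecialTortkara K (Fin 2),
      (∀ i, φ (FreeTortkara.of K i) = freeSpecialTortkara.of K i) ∧ Function.Bijective φ) ∧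
    (∀ n : ℕ, homogeneousComponent K (Fin 2) n =
      Submodule.span K {t | ∃ (i : Fin 2) (l : List (Fin 2)),
        l.length + 1 = n ∧ t = leftNormed K i l}) ∧
    ∃ b : Module.Basis (Fin 2 ⊕ List (Fin 2)) K (FreeTortkara K (Fin 2)),
      ∀ j, b j = leftNormedFamily K j := by
  refine ⟨⟨isTortkara_freeTortkara, FreeZinbiel K (Fin 2), inferInstance, inferInstance,
    inferInstance, inferInstance, isZinbiel_freeZinbiel,
    (NonUnitalSubalgebraClass.subtype (freeSpecialTortkara K (Fin 2))).comp
      FreeTortkara.toSpecial, Subtype.val_injective.comp FreeTortkara.toSpecial_injective⟩,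
    ⟨FreeTortkara.toSpecial, FreeTortkara.toSpecial_of, FreeTortkara.toSpecial_injective,
      FreeTortkara.toSpecial_surjective⟩,
    homogeneousComponent_eq_span_leftNormed, leftNormedBasis K, fun j => ?_⟩
  rw [leftNormedBasis, Module.Basis.mk_apply]
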